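/- For $a\in\mathbb R$ and $k\ge 0$ let $(a)_0=1$ and $(a)_k=a(a+1)\cdots(a+k-1)$. Let $\hat p_m$ denote the Legendre polynomial of degree $m$ with positive leading coefficient, orthonormal in $L^2([-1,1])$. For integers $0\le i\le n$, with $i=0$ or $i$ odd, and $0\le k\le n$ put $$d^i_{n,k}=(-1)^n\frac{\sqrt{2n-2i+1}}{(-n)_i}\,\frac{(-n)_k(n-i+1)_k}{(1)_k(1)_k}\prod_{0\le m\le \frac{i-1}{2}}(n+k+1-2m)\prod_{0\le m\le\frac{i-3}{2}}(n-k-1-2m)$$ (empty products are $1$). For $0\le i\le n$ let $h^n_{n-i}$ be the function on $[-1,1)$ given for $0\le t<1$ by $$h^n_{n-i}(t)=\sum_{k=0}^{n}d^i_{n,k}t^k\ \ (i=0\text{ or }i\text{ odd}),\qquad h^n_{n-i}(t)=\sum_{k=0}^{n-1}d^{i-1}_{n-1,k}t^k\ \ (i>0\text{ even}),$$ and on $[-1,0)$ by the symmetry $h^n_r(-t)=(-1)^{r+1}h^n_r(t)$; let $\psi^n_r(t)=h^n_r(2t-1)\chi_{[0,1)}(t)$ be the associated wavelets. Let $D^n_1$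 be the $(n+1)\times(n+1)$ matrix with entries $$(D^n_1)_{r,s}=2\int_0^1\psi^n_r\!\left(\tfrac{t+1}{2}\right)\hat p_s(2t-1)\,dt=2\int_0^1 h^n_r(t)\,\hat p_s(2t-1)\,dt,\qquad 0\le r,s\le n.$$ **Theorem.** Let $n,i,j$ be non-negative integers with $i$ odd, $j<i-2$ and $i+2\le n$. Then $$(D^n_1)_{n-i+2,n-j}+k^1_{n,i,j}\,(D^n_1)_{n-i,n-j}+k^2_{n,i,j}\,(D^n_1)_{n-i-2,n-j}=0,$$ where, for $j$ even and for $j$ odd alike, $$k^1_{n,i,j}=h\left(\left(cd(a-b)-\frac{b(e-a)(f-a)(g-a)}{a-b-1}\right)\frac{1+a-b}{a(e-b)(f-b)(g-b)}-1\right),$$ $$k^2_{n,i,j}=l\,\frac{b(e-a)(f-a)(g-a)(1+a-b)}{(a-b-1)\,a\,(e-b)(f-b)(g-b)},$$ with $$a=\tfrac{j-i+1}{2},\quad b=-n+\tfrac{i+j}{2},\quad c=-\tfrac j2,\quad d=n+\tfrac{3-j}{2},\quad e=1,\quad f=\tfrac12,\quad g=\tfrac32,$$ $$h=\frac{\sqrt{2(n-i)+5}\,(-2n+i+j-1)}{\sqrt{2(n-i)+1}\,(i-j-2)},\qquad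 l=\frac{\sqrt{2(n-i)+5}\,(2n-i-j-1)(2n-i-j+1)}{\sqrt{2(n-i)-3}\,(i-j)(i-j-2)}.$$ -/

import Mathlib

noncomputable section

namespace AlpertWavelet

/-- The shifted factorial (Pochhammer symbol) `(a)_k = a (a+1) ⋯ (a+k-1)`, with `(a)_0 = 1`. -/
def poch (a : ℝ) (k : ℕ) : ℝ := (ascPochhammer ℝ k).eval a

/-- The Legendre polynomial of degree `m`, orthonormal on `[-1,1]`, with positive leading
coefficient: `√((2m+1)/2) · ₂F₁(-m, m+1; 1; (1-t)/2)`. Mathlib's `shiftedLegendre m` is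
`∑ₖ (-1)ᵏ (m choose k) (m+k choose m) Xᵏ`, that is, the series `₂F₁(-m, m+1; 1; X)`. -/
def legendreON (m : ℕ) (t : ℝ) : ℝ :=
  Real.sqrt (2 * m + 1) / Real.sqrt 2 *
    Polynomial.aeval ((1 - t) / 2) (Polynomial.shiftedLegendre m)

/-- The coefficients `d^i_{n,k}`, used for `0 ≤ k ≤ n`, `i ≤ n`, with `i = 0` or `i` odd.
The products run over `0 ≤ m ≤ (i-1)/2` and `0 ≤ m ≤ (i-3)/2` respectively; for `i = 0` both are
empty, and for `i = 1` the second one is empty. -/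
def waveCoeff (n i k : ℕ) : ℝ :=
  (-1) ^ n * (Real.sqrt (2 * (n : ℝ) - 2 * i + 1) / poch (-(n : ℝ)) i) *
    (poch (-(n : ℝ)) k * poch ((n : ℝ) - i + 1) k / (poch 1 k * poch 1 k)) *
    (∏ m ∈ Finset.range ((i + 1) / 2), ((n : ℝ) + k + 1 - 2 * m)) *
    (∏ m ∈ Finset.range ((i - 1) / 2), ((n : ℝ) - k - 1 - 2 * m))

/-- The polynomial in `t` that gives `h^n_{n-i}` on `[0,1)`. -/
def wavePoly (n i : ℕ) (t : ℝ) : ℝ :=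
  if i = 0 ∨ Odd i then ∑ k ∈ Finset.range (n + 1), waveCoeff n i k * t ^ k
  else ∑ k ∈ Finset.range n, waveCoeff (n - 1) (i - 1) k * t ^ k

/-- The function `h^n_r`, for `r ≤ n`: a polynomial on `[0,1)`, continued to `[-1,0)` by
`h^n_r(-t) = (-1)^{r+1} h^n_r(t)`, and zero elsewhere. -/
def waveFun (n r : ℕ) (t : ℝ) : ℝ :=
  if 0 ≤ t ∧ t < 1 then wavePoly n (n - r) t
  else if -1 ≤ t ∧ t < 0 then (-1) ^ (r + 1) * wavePoly n (n - r) (-t)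
  else 0

/-- The wavelet `ψ^n_r(t) = h^n_r(2t-1) χ_{[0,1)}(t)`. -/
def wavelet (n r : ℕ) (t : ℝ) : ℝ :=
  (Set.Ico (0 : ℝ) 1).indicator (fun s => waveFun n r (2 * s - 1)) t

/-- The `(n+1) × (n+1)` matrix `D^n_1`, with rows and columns numbered `0, …, n`:
`(D^n_1)_{r,s} = 2 ∫₀¹ ψ^n_r((t+1)/2) p̂_s(2t-1) dt`. -/
def matD (n : ℕ) : Matrix (Fin (n + 1)) (Fin (n + 1)) ℝ :=
  Matrix.of fun r s =>
    2 * ∫ t in (0 : ℝ)..1, wavelet n (r : ℕ) ((t + 1) / 2) * legendreON (s : ℕ) (2 * t - 1)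

/-- The general shape of the coefficient `k^1`, in terms of the parameters of a `₄F₃` series and a
factor `h`. -/
def coeffOne (a b c d e f g h : ℝ) : ℝ :=
  h * ((c * d * (a - b) - b * (e - a) * (f - a) * (g - a) / (a - b - 1)) *
    ((1 + a - b) / (a * (e - b) * (f - b) * (g - b))) - 1)

/-- The general shape of the coefficient `k^2`, in terms of the parameters of a `₄F₃` series and a
factor `l`. -/
def coeffTwo (a b e f g l : ℝ) : ℝ :=
  l * (b * (e - a) * (f - a) * (g - a) * (1 + a - b) /
    ((a - b - 1) * a * (e - b) * (f - b) * (g - b)))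

/-- The coefficient `k^1_{n,i,j}`. -/
def kOne (n i j : ℝ) : ℝ :=
  coeffOne ((j - i + 1) / 2) (-n + (i + j) / 2) (-(j / 2)) (n + (3 - j) / 2) 1 (1 / 2) (3 / 2)
    (Real.sqrt (2 * (n - i) + 5) * (-2 * n + i + j - 1) /
      (Real.sqrt (2 * (n - i) + 1) * (i - j - 2)))

/-- The coefficient `k^2_{n,i,j}`. -/
def kTwo (n i j : ℝ) : ℝ :=
  coeffTwo ((j - i + 1) / 2) (-n + (i + j) / 2) 1 (1 / 2) (3 / 2)
    (Real.sqrt (2 * (n - i) + 5) * (2 * n - i - j - 1) * (2 * n - i - j + 1) /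
      (Real.sqrt (2 * (n - i) - 3) * (i - j) * (i - j - 2)))

end AlpertWavelet

end

namespace AlpertWavelet

open Finset Polynomial

/-! Up to a factor depending only on the column and a square root depending only on the row, each
entry is `∑ k, ratCoeff n i k * moment (n - j) k`. Orthogonality kills the powers below `n - j`, so
with `k = n - x` only `0 ≤ x ≤ j` remains. The summand `T i x` (`momentTerm`) is hypergeometric: the
ratios `T (i+2) x / T i x` and `T i (x+2) / T i x` are rational. The recurrence is proved by
creative telescoping: `T i x + k₁ T (i+2) x + k₂ T (i+4) x` is a constant times `G (x+2) - G x`,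
where `G x = x (2n-x+3) T (i+2) x`. Dividing by `T (i+2) x` leaves the rational identity
`certificate`; all boundary values of `G` vanish. The square roots in `kOne` and `kTwo` only
equalise the row normalisations. -/

/-! ### Ratios of the wavelet coefficients in `i` and `k`. -/

theorem poch_succ (a : ℝ) (k : ℕ) : poch a (k + 1) = poch a k * (a + k) :=
  ascPochhammer_succ_eval k a

theorem mul_poch_add_one (a : ℝ) (k : ℕ) : a * poch (a + 1) k = poch a k * (a + k) := by
  induction k with
  | zero => simp [poch]
  | succ k ih =>
    rw [poch_succ, poch_succ, ← mul_assoc, ih]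
    push_cast
    ring

theorem poch_one_pos (k : ℕ) : 0 < poch 1 k :=
  ascPochhammer_pos k 1 one_pos

theorem prod_arith_shift (y : ℝ) (M : ℕ) :
    (∏ m ∈ range M, (y + 2 - 2 * (m : ℝ))) * (y + 2 - 2 * M) =
      (y + 2) * ∏ m ∈ range M, (y - 2 * (m : ℝ)) := by
  induction M with
  | zero => simp
  | succ M ih =>
    rw [prod_range_succ, prod_range_succ]
    push_cast
    linear_combination (y - 2 * M) * ih

/-- The coefficient `d^i_{n,k}` without its factor `√(2n-2i+1)`. -/
noncomputable def ratCoeff (n i k : ℕ) : ℝ :=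
  (-1) ^ n * (1 / poch (-(n : ℝ)) i) *
    (poch (-(n : ℝ)) k * poch ((n : ℝ) - i + 1) k / (poch 1 k * poch 1 k)) *
    (∏ m ∈ range ((i + 1) / 2), ((n : ℝ) + k + 1 - 2 * m)) *
    (∏ m ∈ range ((i - 1) / 2), ((n : ℝ) - k - 1 - 2 * m))

theorem waveCoeff_eq (n i k : ℕ) :
    waveCoeff n i k = Real.sqrt (2 * (n : ℝ) - 2 * i + 1) * ratCoeff n i k := by
  unfold waveCoeff ratCoeff
  ring

/-- Each product gains one factor, `n + k - i` and `n - k - i`. The shifted Pochhammer symbols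
contribute the rest, and `n + k - i` cancels. -/
theorem ratCoeff_add_two (n i k : ℕ) (hi : Odd i) (hin : i + 2 ≤ n) :
    ratCoeff n (i + 2) k * ((n : ℝ) + k - i - 1) = ratCoeff n i k * ((n : ℝ) - k - i) := by
  obtain ⟨q, rfl⟩ := hi
  have hn : ((2 * q + 1 : ℕ) : ℝ) + 2 ≤ n := by exact_mod_cast hin
  have hk : (0 : ℝ) ≤ k := k.cast_nonneg
  have e1 : (2 * q + 1 + 2 + 1) / 2 = q + 1 + 1 := by omega
  have e2 : (2 * q + 1 + 2 - 1) / 2 = q + 1 := by omega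
  have e3 : (2 * q + 1 + 1) / 2 = q + 1 := by omega
  have e4 : (2 * q + 1 - 1) / 2 = q := by omega
  unfold ratCoeff
  rw [e1, e2, e3, e4, prod_range_succ _ (q + 1),
    prod_range_succ (fun m : ℕ => (n : ℝ) - k - 1 - 2 * m) q, poch_succ, poch_succ]
  have h1 := mul_poch_add_one ((n : ℝ) - (2 * q + 1 : ℕ) - 1) k
  have h2 := mul_poch_add_one ((n : ℝ) - (2 * q + 1 : ℕ)) k
  rw [show (n : ℝ) - (2 * q + 1 : ℕ) - 1 + 1 = (n : ℝ) - (2 * q + 1 : ℕ) by ring] at h1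
  rw [show (n : ℝ) - ((2 * q + 1 + 2 : ℕ) : ℝ) + 1 = (n : ℝ) - (2 * q + 1 : ℕ) - 1 by
    push_cast; ring]
  generalize ∏ m ∈ range (q + 1), ((n : ℝ) + k + 1 - 2 * m) = U
  generalize ∏ m ∈ range q, ((n : ℝ) - k - 1 - 2 * m) = V
  generalize poch ((n : ℝ) - (2 * q + 1 : ℕ) - 1) k = A at *
  generalize poch ((n : ℝ) - (2 * q + 1 : ℕ)) k = B at *
  generalize poch ((n : ℝ) - (2 * q + 1 : ℕ) + 1) k = C at *
  push_cast at *
  have hd1 : (n : ℝ) - (2 * q + 1) ≠ 0 := by intro h; linarith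
  have hd2 : (n : ℝ) - (2 * q + 1) - 1 ≠ 0 := by intro h; linarith
  have hd3 : -(n : ℝ) + (2 * q + 1) ≠ 0 := by intro h; linarith
  have hd4 : -(n : ℝ) + (2 * q + 1 + 1) ≠ 0 := by intro h; linarith
  have hB : B = A * (n - (2 * q + 1) - 1 + k) / (n - (2 * q + 1) - 1) := by
    field_simp; linear_combination h1
  have hC : C = B * (n - (2 * q + 1) + k) / (n - (2 * q + 1)) := by
    field_simp; linear_combination h2
  rw [hC, hB]
  have hinv : (1 : ℝ) / (poch (-(n : ℝ)) (2 * q + 1) * (-(n : ℝ) + (2 * q + 1)) *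
      (-(n : ℝ) + (2 * q + 1 + 1))) = 1 / poch (-(n : ℝ)) (2 * q + 1) *
      (1 / ((n - (2 * q + 1)) * (n - (2 * q + 1) - 1))) := by
    rw [one_div_mul_one_div]
    congr 1
    ring
  rw [hinv]
  generalize 1 / poch (-(n : ℝ)) (2 * q + 1) = P
  generalize (poch 1 k : ℝ) = R
  field_simp
  ring

/-- The step in `k` is two because the factors of the products are spaced by two: each product then
changes only at its ends. -/
theorem ratCoeff_shift (n i k : ℕ) (hi : Odd i) (hin : i ≤ n) (hk : k + 2 ≤ n) :
    ratCoeff n i (k + 2) * (((k : ℝ) + 1) ^ 2 * ((k : ℝ) + 2) ^ 2) =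
      ratCoeff n i k *
        (((n : ℝ) - k) * ((n : ℝ) + k + 3) * ((n : ℝ) - k - i) * ((n : ℝ) + k + 1 - i)) := by
  obtain ⟨q, rfl⟩ := hi
  have hn : ((2 * q + 1 : ℕ) : ℝ) ≤ n := by exact_mod_cast hin
  have hkn : (k : ℝ) + 2 ≤ n := by exact_mod_cast hk
  have hk0 : (0 : ℝ) ≤ k := k.cast_nonneg
  have e3 : (2 * q + 1 + 1) / 2 = q + 1 := by omega
  have e4 : (2 * q + 1 - 1) / 2 = q := by omega
  have p1 := prod_arith_shift ((n : ℝ) + k + 1) (q + 1)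
  have p2 := prod_arith_shift ((n : ℝ) - k - 3) q
  unfold ratCoeff
  rw [e3, e4]
  simp only [poch_succ _ (k + 1), poch_succ _ k]
  have s1 : ∀ m : ℕ, (n : ℝ) + ((k + 2 : ℕ) : ℝ) + 1 - 2 * m = n + k + 1 + 2 - 2 * m := by
    intro m; push_cast; ring
  have s2 : ∀ m : ℕ, (n : ℝ) - ((k + 2 : ℕ) : ℝ) - 1 - 2 * m = n - k - 3 - 2 * m := by
    intro m; push_cast; ring
  have s3 : ∀ m : ℕ, (n : ℝ) - k - 3 + 2 - 2 * m = n - k - 1 - 2 * m := by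
    intro m; ring
  simp only [s1, s2]
  simp only [s3] at p2
  have hR := (poch_one_pos k).ne'
  generalize ∏ m ∈ range (q + 1), ((n : ℝ) + k + 1 - 2 * m) = U at *
  generalize ∏ m ∈ range q, ((n : ℝ) - k - 1 - 2 * m) = V at *
  generalize ∏ m ∈ range (q + 1), ((n : ℝ) + k + 1 + 2 - 2 * m) = U' at *
  generalize ∏ m ∈ range q, ((n : ℝ) - k - 3 - 2 * m) = V' at *
  generalize 1 / poch (-(n : ℝ)) (2 * q + 1) = P
  generalize poch (-(n : ℝ)) k = A
  generalize poch ((n : ℝ) - (2 * q + 1 : ℕ) + 1) k = B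
  generalize (poch 1 k : ℝ) = R at *
  push_cast at *
  have hd1 : (n : ℝ) + k + 1 + 2 - 2 * (q + 1) ≠ 0 := by intro h; linarith
  have hd2 : (n : ℝ) - k - 3 + 2 ≠ 0 := by intro h; linarith
  have hU : U' = (n + k + 1 + 2) * U / (n + k + 1 + 2 - 2 * (q + 1)) := by
    rw [eq_div_iff hd1, p1]
  have hV : V' = V * (n - k - 1 - 2 * q) / (n - k - 3 + 2) := by
    rw [eq_div_iff hd2, p2]; ring
  have hk1 : (1 : ℝ) + k ≠ 0 := by positivity
  have hk2 : (1 : ℝ) + (k + 1) ≠ 0 := by positivity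
  rw [hU, hV]
  field_simp
  ring

/-! ### Moments of the shifted Legendre polynomials. -/

/-- The moment `∫₀¹ tᵏ P(t) dt` of Mathlib's shifted Legendre polynomial `P` of degree `s`. -/
noncomputable def moment (s k : ℕ) : ℝ :=
  ∑ m ∈ range (s + 1), (-1 : ℝ) ^ m * s.choose m * (s + m).choose s / (k + m + 1)

theorem legendre_coeff_succ (s m : ℕ) :
    (-1 : ℝ) ^ (m + 1) * s.choose (m + 1) * (s + (m + 1)).choose s * ((m : ℝ) + 1) ^ 2 =
      -((-1 : ℝ) ^ m * s.choose m * (s + m).choose s) * (((s : ℝ) - m) * (s + m + 1)) := by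
  have h1 : (s.choose (m + 1) : ℝ) * (m + 1) = s.choose m * (s - m) := by
    rcases le_or_gt m s with h | h
    · have := Nat.choose_succ_right_eq s m
      rw [← Nat.cast_sub h]
      exact_mod_cast this
    · rw [Nat.choose_eq_zero_of_lt h, Nat.choose_eq_zero_of_lt (by omega)]
      simp
  have h2 : ((s + (m + 1)).choose s : ℝ) * (m + 1) = (s + m).choose s * (s + m + 1) := by
    have := Nat.choose_mul_succ_eq (s + m) s
    rw [show s + m + 1 - s = m + 1 by omega] at this
    exact_mod_cast this.symm
  rw [pow_succ]
  linear_combination (-(-1 : ℝ) ^ m * ((s + (m + 1)).choose s : ℝ) * (m + 1)) * h1 -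
    ((-1 : ℝ) ^ m * s.choose m * (s - m)) * h2

theorem moment_succ (s k : ℕ) :
    ((k : ℝ) + 1 - s) * (k + s + 2) * moment s (k + 1) = ((k : ℝ) + 1) ^ 2 * moment s k := by
  unfold moment
  set c : ℕ → ℝ := fun m => (-1 : ℝ) ^ m * s.choose m * (s + m).choose s with hc
  have hstep : ∀ m, c (m + 1) * ((m : ℝ) + 1) ^ 2 = -c m * (((s : ℝ) - m) * (s + m + 1)) :=
    legendre_coeff_succ s
  have hzero : c (s + 1) = 0 := by simp [hc]
  change _ * ∑ m ∈ range (s + 1), c m / _ = _ * ∑ m ∈ range (s + 1), c m / _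
  rw [mul_sum, mul_sum, ← sub_eq_zero, ← sum_sub_distrib]
  -- Telescoping in `m`: `m² c m / (k+m+1)` vanishes at `m = 0` through `m²` and at `m = s + 1`
  -- through `c`.
  have key : ∀ m ∈ range (s + 1),
      ((k : ℝ) + 1 - s) * (k + s + 2) * (c m / ((k + 1 : ℕ) + m + 1)) -
        ((k : ℝ) + 1) ^ 2 * (c m / (k + m + 1)) =
      (fun m : ℕ => (m : ℝ) ^ 2 * c m / (k + m + 1)) (m + 1) -
        (fun m : ℕ => (m : ℝ) ^ 2 * c m / (k + m + 1)) m := by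
    intro m _
    have h1 : (k : ℝ) + m + 1 ≠ 0 := by positivity
    have h2 : (k : ℝ) + 1 + m + 1 ≠ 0 := by positivity
    have h3 : (k : ℝ) + (m + 1) + 1 ≠ 0 := by positivity
    have h := hstep m
    push_cast
    rw [mul_comm (((m : ℝ) + 1) ^ 2), h]
    field_simp
    ring
  rw [sum_congr rfl key]
  exact (sum_range_sub (fun m : ℕ => (m : ℝ) ^ 2 * c m / (k + m + 1)) _).trans (by simp [hzero])

/-- `moment_succ` propagates the zero, since its left factor `k + 1 - s` is nonzero while `k + 1 <
s`. The case `k = 0` needs its own telescoping sum. -/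
theorem moment_eq_zero {s k : ℕ} (h : k < s) : moment s k = 0 := by
  induction k with
  | zero =>
    have hstep := legendre_coeff_succ s
    set c : ℕ → ℝ := fun m => (-1 : ℝ) ^ m * s.choose m * (s + m).choose s with hc
    have hs : (s : ℝ) * (s + 1) ≠ 0 := by
      have : (0 : ℝ) < s := by exact_mod_cast h
      positivity
    have hzero : c (s + 1) = 0 := by simp [hc]
    have hm : moment s 0 = ∑ m ∈ range (s + 1), c m / (((0 : ℕ) : ℝ) + m + 1) := rfl
    refine (mul_eq_zero.mp ?_).resolve_left hs
    rw [hm, mul_sum]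
    have key : ∀ m ∈ range (s + 1), (s : ℝ) * (s + 1) * (c m / (((0 : ℕ) : ℝ) + m + 1)) =
        (fun m : ℕ => -(m : ℝ) * c m) (m + 1) - (fun m : ℕ => -(m : ℝ) * c m) m := by
      intro m _
      have h1 : (m : ℝ) + 1 ≠ 0 := by positivity
      have h : c (m + 1) * ((m : ℝ) + 1) ^ 2 = -c m * (((s : ℝ) - m) * (s + m + 1)) := hstep m
      push_cast
      rw [zero_add]
      field_simp
      linear_combination h
    rw [sum_congr rfl key]
    exact (sum_range_sub (fun m : ℕ => -(m : ℝ) * c m) _).trans (by simp [hzero])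
  | succ k ih =>
    have h0 := moment_succ s k
    rw [ih (by omega), mul_zero] at h0
    refine (mul_eq_zero.mp h0).resolve_left ?_
    have h1 : (k : ℝ) + 1 < s := by exact_mod_cast h
    have h2 : (0 : ℝ) ≤ k := k.cast_nonneg
    have : (k : ℝ) + s + 2 ≠ 0 := by positivity
    exact mul_ne_zero (by intro h; linarith) this

/-! ### Matrix entries as finite sums of moments. -/

theorem aeval_shiftedLegendre (s : ℕ) (t : ℝ) :
    aeval t (shiftedLegendre s) =
      ∑ m ∈ range (s + 1), (-1 : ℝ) ^ m * s.choose m * (s + m).choose s * t ^ m := by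
  simp [shiftedLegendre]

theorem integral_pow_mul_shiftedLegendre (s k : ℕ) :
    ∫ t in (0 : ℝ)..1, t ^ k * aeval t (shiftedLegendre s) = moment s k := by
  simp_rw [aeval_shiftedLegendre, mul_sum]
  rw [intervalIntegral.integral_finsetSum
    (fun m _ => Continuous.intervalIntegrable (by fun_prop) _ _)]
  refine sum_congr rfl fun m _ => ?_
  have : ∀ t : ℝ, t ^ k * ((-1 : ℝ) ^ m * s.choose m * (s + m).choose s * t ^ m) =
      (-1 : ℝ) ^ m * s.choose m * (s + m).choose s * t ^ (k + m) := by
    intro t; rw [pow_add]; ring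
  simp_rw [this]
  rw [intervalIntegral.integral_const_mul, integral_pow]
  simp [div_eq_mul_inv]

theorem legendreON_two_mul_sub_one (s : ℕ) (t : ℝ) :
    legendreON s (2 * t - 1) =
      Real.sqrt (2 * s + 1) / Real.sqrt 2 * (-1) ^ s * aeval t (shiftedLegendre s) := by
  unfold legendreON
  rw [shiftedLegendre_eval_symm s ((1 - (2 * t - 1)) / 2), mul_assoc _ ((-1 : ℝ) ^ s)]
  congr 4
  ring

theorem wavelet_half (n r : ℕ) {t : ℝ} (ht : t ∈ Set.Ioo (0 : ℝ) 1) :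
    wavelet n r ((t + 1) / 2) = wavePoly n (n - r) t := by
  obtain ⟨h0, h1⟩ := ht
  have hmem : (t + 1) / 2 ∈ Set.Ico (0 : ℝ) 1 := ⟨by linarith, by linarith⟩
  unfold wavelet
  rw [Set.indicator_of_mem hmem, show 2 * ((t + 1) / 2) - 1 = t by ring]
  unfold waveFun
  rw [if_pos ⟨h0.le, h1⟩]

theorem matD_apply_of_odd {n i r s : ℕ} (hr : r < n + 1) (hs : s < n + 1) (hri : n - r = i)
    (hi : Odd i) :
    matD n ⟨r, hr⟩ ⟨s, hs⟩ =
      2 * (Real.sqrt (2 * s + 1) / Real.sqrt 2 * (-1) ^ s) *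
        (Real.sqrt (2 * (n : ℝ) - 2 * i + 1) *
          ∑ k ∈ range (n + 1), ratCoeff n i k * moment s k) := by
  have hint : ∫ t in (0 : ℝ)..1, wavelet n r ((t + 1) / 2) * legendreON s (2 * t - 1) =
      ∫ t in (0 : ℝ)..1, ∑ k ∈ range (n + 1),
        (Real.sqrt (2 * s + 1) / Real.sqrt 2 * (-1) ^ s * waveCoeff n i k) *
          (t ^ k * aeval t (shiftedLegendre s)) := by
    -- The open interval is needed: at `t = 1` the wavelet is cut off to zero.
    refine intervalIntegral.integral_congr_Ioo_of_le zero_le_one fun t ht => ?_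
    rw [wavelet_half n r ht, hri, legendreON_two_mul_sub_one, wavePoly, if_pos (Or.inr hi),
      sum_mul]
    exact sum_congr rfl fun k _ => by ring
  change 2 * ∫ t in (0 : ℝ)..1, wavelet n r ((t + 1) / 2) * legendreON s (2 * t - 1) = _
  rw [hint, intervalIntegral.integral_finsetSum
    (fun k _ => Continuous.intervalIntegrable (by fun_prop) _ _)]
  simp_rw [intervalIntegral.integral_const_mul, integral_pow_mul_shiftedLegendre, waveCoeff_eq,
    mul_sum]
  exact sum_congr rfl fun k _ => by ring

/-! ### The hypergeometric summand and its ratios. -/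

/-- The summand of `∫₀¹ h^n_{n-i} P_{n-j}` that belongs to the power `t^(n-x)`, up to constants. -/
noncomputable def momentTerm (n i j x : ℕ) : ℝ :=
  ratCoeff n i (n - x) * moment (n - j) (n - x)

theorem sum_ratCoeff_mul_moment (n i j : ℕ) (hj : j ≤ n) :
    ∑ k ∈ range (n + 1), ratCoeff n i k * moment (n - j) k =
      ∑ x ∈ range (j + 1), momentTerm n i j x := by
  rw [← sum_range_reflect]
  have hsub : range (j + 1) ⊆ range (n + 1) := by
    intro x; simp only [mem_range]; omega
  symm
  refine (sum_subset hsub fun x hx hxj => ?_).trans (sum_congr rfl fun x _ => ?_)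
  · simp only [mem_range] at hx hxj
    rw [momentTerm, moment_eq_zero (by omega), mul_zero]
  · rw [momentTerm, show n + 1 - 1 - x = n - x by omega]

theorem momentTerm_add_two (n i j x : ℕ) (hi : Odd i) (hin : i + 2 ≤ n) (hx : x ≤ n) :
    momentTerm n (i + 2) j x * (2 * (n : ℝ) - i - 1 - x) = momentTerm n i j x * ((x : ℝ) - i) := by
  have h := ratCoeff_add_two n i (n - x) hi hin
  rw [Nat.cast_sub hx] at h
  unfold momentTerm
  linear_combination moment (n - j) (n - x) * h

/-- With `k = n - x - 2`, two steps of `moment_succ` produce `(k+1)² (k+2)²`, which cancels the same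
factor in `ratCoeff_shift`. -/
theorem momentTerm_shift (n i j x : ℕ) (hi : Odd i) (hin : i ≤ n) (hj : j ≤ n) (hx : x + 2 ≤ n) :
    ((x : ℝ) + 2) * (2 * n - x + 1) * (x - i + 2) * (2 * n - i - 1 - x) *
        momentTerm n i j (x + 2) =
      ((j : ℝ) - x) * (j - x - 1) * (2 * n - x - j + 1) * (2 * n - x - j) *
        momentTerm n i j x := by
  obtain ⟨k, rfl⟩ : ∃ k, n = k + x + 2 := ⟨n - x - 2, by omega⟩
  have hs : (((k + x + 2 - j : ℕ)) : ℝ) = k + x + 2 - j := by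
    rw [Nat.cast_sub hj]; push_cast; ring
  have h1 := moment_succ (k + x + 2 - j) k
  have h2 := moment_succ (k + x + 2 - j) (k + 1)
  have h3 := ratCoeff_shift (k + x + 2) i k hi hin (by omega)
  unfold momentTerm
  rw [show k + x + 2 - (x + 2) = k by omega, show k + x + 2 - x = k + 2 by omega]
  rw [hs] at h1 h2
  push_cast at *
  generalize moment (k + x + 2 - j) k = m0 at *
  generalize moment (k + x + 2 - j) (k + 1) = m1 at *
  generalize moment (k + x + 2 - j) (k + 1 + 1) = m2 at *
  generalize ratCoeff (k + x + 2) i k = c0 at *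
  generalize ratCoeff (k + x + 2) i (k + 2) = c2 at *
  have h2' : ((j : ℝ) - x) * (2 * (k + x + 2) - x - j + 1) * m2 = ((k : ℝ) + 2) ^ 2 * m1 := by
    linear_combination h2
  have h1' : ((j : ℝ) - x - 1) * (2 * (k + x + 2) - x - j) * m1 = ((k : ℝ) + 1) ^ 2 * m0 := by
    linear_combination h1
  linear_combination (-m0) * h3 - c2 * ((j : ℝ) - x - 1) * (2 * (k + x + 2) - x - j) * h2' -
    c2 * ((k : ℝ) + 2) ^ 2 * h1'

/-! ### Rational coefficients and the telescoping certificate. -/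

/-- `kOne` without its square roots. -/
noncomputable def ratOne (n i j : ℝ) : ℝ :=
  coeffOne ((j - i + 1) / 2) (-n + (i + j) / 2) (-(j / 2)) (n + (3 - j) / 2) 1 (1 / 2) (3 / 2)
    ((-2 * n + i + j - 1) / (i - j - 2))

/-- `kTwo` without its square roots. -/
noncomputable def ratTwo (n i j : ℝ) : ℝ :=
  coeffTwo ((j - i + 1) / 2) (-n + (i + j) / 2) 1 (1 / 2) (3 / 2)
    ((2 * n - i - j - 1) * (2 * n - i - j + 1) / ((i - j) * (i - j - 2)))

theorem kOne_eq (n i j : ℝ) :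
    kOne n i j = Real.sqrt (2 * (n - i) + 5) / Real.sqrt (2 * (n - i) + 1) * ratOne n i j := by
  unfold kOne ratOne coeffOne
  rw [mul_div_mul_comm]
  ring

theorem kTwo_eq (n i j : ℝ) :
    kTwo n i j = Real.sqrt (2 * (n - i) + 5) / Real.sqrt (2 * (n - i) - 3) * ratTwo n i j := by
  unfold kTwo ratTwo coeffTwo
  rw [mul_assoc (Real.sqrt _), mul_assoc (Real.sqrt _), mul_div_mul_comm]
  ring

theorem ratOne_eq {n i j : ℝ} (hji : j + 3 ≤ i) (hin : i + 2 ≤ n) :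
    ratOne n i j =
      ((2 * n - 2 * i + 3) * ((i - j + 1) * (i - j) * (i - j + 2) * (2 * n - i - j) -
          j * (2 * n + 3 - j) * (2 * n - 2 * i + 1) * (2 * n - 2 * i - 1)) +
        (2 * n - i - j + 1) * (i - j - 1) * (2 * n - i - j + 2) * (2 * n - i - j + 3) *
          (2 * n - 2 * i - 1)) /
      ((2 * n - 2 * i - 1) *
        ((i - j - 2) * (i - j - 1) * (2 * n - i - j + 3) * (2 * n - i - j + 2))) := by
  have d3 : i - j - 2 ≠ 0 := by intro h; linarith
  have d4 : i - j - 1 ≠ 0 := by intro h; linarith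
  have d5 : 2 * n - i - j + 3 ≠ 0 := by intro h; linarith
  have d6 : 2 * n - i - j + 2 ≠ 0 := by intro h; linarith
  have d8 : 2 * n - i - j + 1 ≠ 0 := by intro h; linarith
  have d9 : 2 * n - 2 * i - 1 ≠ 0 := by intro h; linarith
  unfold ratOne coeffOne
  rw [show (j - i + 1) / 2 = -(i - j - 1) / 2 by ring,
    show -n + (i + j) / 2 = -(2 * n - i - j) / 2 by ring,
    show -(i - j - 1) / 2 - -(2 * n - i - j) / 2 - 1 = (2 * n - 2 * i - 1) / 2 by ring,
    show 1 - -(2 * n - i - j) / 2 = (2 * n - i - j + 2) / 2 by ring,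
    show 1 / 2 - -(2 * n - i - j) / 2 = (2 * n - i - j + 1) / 2 by ring,
    show 3 / 2 - -(2 * n - i - j) / 2 = (2 * n - i - j + 3) / 2 by ring]
  generalize hw : 2 * n - 2 * i - 1 = w at *
  field_simp
  subst hw
  ring

theorem ratTwo_eq {n i j : ℝ} (hji : j + 3 ≤ i) (hin : i + 2 ≤ n) :
    ratTwo n i j =
      (2 * n - i - j - 1) * (2 * n - i - j) * (i - j + 1) * (i - j + 2) * (2 * n - 2 * i + 3) /
      ((2 * n - 2 * i - 1) *
        ((i - j - 2) * (i - j - 1) * (2 * n - i - j + 3) * (2 * n - i - j + 2))) := by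
  have d3 : i - j - 2 ≠ 0 := by intro h; linarith
  have d4 : i - j - 1 ≠ 0 := by intro h; linarith
  have d5 : 2 * n - i - j + 3 ≠ 0 := by intro h; linarith
  have d6 : 2 * n - i - j + 2 ≠ 0 := by intro h; linarith
  have d7 : i - j ≠ 0 := by intro h; linarith
  have d8 : 2 * n - i - j + 1 ≠ 0 := by intro h; linarith
  have d9 : 2 * n - 2 * i - 1 ≠ 0 := by intro h; linarith
  unfold ratTwo coeffTwo
  rw [show (j - i + 1) / 2 = -(i - j - 1) / 2 by ring,
    show -n + (i + j) / 2 = -(2 * n - i - j) / 2 by ring,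
    show -(i - j - 1) / 2 - -(2 * n - i - j) / 2 - 1 = (2 * n - 2 * i - 1) / 2 by ring,
    show 1 - -(2 * n - i - j) / 2 = (2 * n - i - j + 2) / 2 by ring,
    show 1 / 2 - -(2 * n - i - j) / 2 = (2 * n - i - j + 1) / 2 by ring,
    show 3 / 2 - -(2 * n - i - j) / 2 = (2 * n - i - j + 3) / 2 by ring]
  field_simp
  ring

/-- The rational function identity behind the telescoping of the recurrence. -/
theorem certificate {n i j x : ℝ} (hji : j + 3 ≤ i) (hin : i + 2 ≤ n) (hxj : x ≤ j) :
    (2 * n - i + 1 - x) / (x - i + 2) + ratOne n i j +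
        ratTwo n i j * ((x - i) / (2 * n - i - 1 - x)) =
      (2 * n - 2 * i + 3) * (2 * n - 2 * i + 1) /
          ((i - j - 2) * (i - j - 1) * (2 * n - i - j + 3) * (2 * n - i - j + 2)) *
        ((j - x) * (j - x - 1) * (2 * n - x - j + 1) * (2 * n - x - j) /
          ((x - i + 2) * (2 * n - i - 1 - x)) - x * (2 * n - x + 3)) := by
  have d1 : x - i + 2 ≠ 0 := by intro h; linarith
  have d2 : 2 * n - i - 1 - x ≠ 0 := by intro h; linarith
  have d9 : 2 * n - 2 * i - 1 ≠ 0 := by intro h; linarith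
  have hD : (i - j - 2) * (i - j - 1) * (2 * n - i - j + 3) * (2 * n - i - j + 2) ≠ 0 := by
    refine mul_ne_zero (mul_ne_zero (mul_ne_zero ?_ ?_) ?_) ?_ <;> intro h <;> linarith
  rw [ratOne_eq hji hin, ratTwo_eq hji hin]
  -- The denominators become atoms while fractions are cleared, and are restored for the final
  -- polynomial identity.
  generalize hDe : (i - j - 2) * (i - j - 1) * (2 * n - i - j + 3) * (2 * n - i - j + 2) = D at *
  generalize hw : 2 * n - 2 * i - 1 = w at *
  generalize hy : x - i + 2 = y at *
  generalize hz : 2 * n - i - 1 - x = z at *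
  field_simp
  subst hDe hw hy hz
  ring

/-- All four other terms are multiples of the middle one, `momentTerm n (i + 2) j x`. In the shifted
term the factor `(x+2)(2n-x+1)` is exactly what `momentTerm_shift` absorbs. -/
theorem momentTerm_recurrence (n i j x : ℕ) (hi : Odd i) (hji : j + 3 ≤ i + 2)
    (hin : i + 4 ≤ n) (hxj : x ≤ j) :
    momentTerm n i j x + ratOne n (i + 2 : ℕ) j * momentTerm n (i + 2) j x +
        ratTwo n (i + 2 : ℕ) j * momentTerm n (i + 4) j x =
      (2 * (n : ℝ) - 2 * (i + 2 : ℕ) + 3) * (2 * n - 2 * (i + 2 : ℕ) + 1) /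
          (((i + 2 : ℕ) - j - 2) * ((i + 2 : ℕ) - j - 1) * (2 * n - (i + 2 : ℕ) - j + 3) *
            (2 * n - (i + 2 : ℕ) - j + 2)) *
        (((x + 2 : ℕ) : ℝ) * (2 * n - (x + 2 : ℕ) + 3) * momentTerm n (i + 2) j (x + 2) -
          (x : ℝ) * (2 * n - x + 3) * momentTerm n (i + 2) j x) := by
  have hi2 : Odd (i + 2) := hi.add_even even_two
  have hA := momentTerm_add_two n i j x hi (by omega) (by omega)
  have hB := momentTerm_add_two n (i + 2) j x hi2 (by omega) (by omega)
  have hC := momentTerm_shift n (i + 2) j x hi2 (by omega) (by omega) (by omega)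
  have hji' : (j : ℝ) + 3 ≤ (i + 2 : ℕ) := by exact_mod_cast hji
  have hin' : ((i + 2 : ℕ) : ℝ) + 2 ≤ n := by exact_mod_cast hin
  have hxj' : (x : ℝ) ≤ j := by exact_mod_cast hxj
  have cert := certificate hji' hin' hxj'
  rw [show (i : ℝ) = (i + 2 : ℕ) - 2 by push_cast; ring] at hA
  rw [show i + 2 + 2 = i + 4 by ring] at hB
  rw [show ((x + 2 : ℕ) : ℝ) = x + 2 by push_cast; ring]
  generalize ((i + 2 : ℕ) : ℝ) = I at *
  have d1 : (x : ℝ) - I + 2 ≠ 0 := by intro h; linarith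
  have d2 : 2 * (n : ℝ) - I - 1 - x ≠ 0 := by intro h; linarith
  have hA' : momentTerm n i j x =
      (2 * n - I + 1 - x) / (x - I + 2) * momentTerm n (i + 2) j x := by
    rw [div_mul_eq_mul_div, eq_div_iff d1]
    linear_combination -hA
  have hB' : momentTerm n (i + 4) j x =
      (x - I) / (2 * n - I - 1 - x) * momentTerm n (i + 2) j x := by
    rw [div_mul_eq_mul_div, eq_div_iff d2]
    linear_combination hB
  have hC' : ((x : ℝ) + 2) * (2 * n - (x + 2) + 3) * momentTerm n (i + 2) j (x + 2) =
      (j - x) * (j - x - 1) * (2 * n - x - j + 1) * (2 * n - x - j) /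
          ((x - I + 2) * (2 * n - I - 1 - x)) * momentTerm n (i + 2) j x := by
    rw [div_mul_eq_mul_div, eq_div_iff (mul_ne_zero d1 d2)]
    linear_combination hC
  rw [hA', hB', hC']
  linear_combination momentTerm n (i + 2) j x * cert

/-! ### Summation and boundary terms. -/

theorem sum_range_add_two_sub (G : ℕ → ℝ) (N : ℕ) :
    ∑ x ∈ range N, (G (x + 2) - G x) = G N + G (N + 1) - G 0 - G 1 := by
  induction N with
  | zero => simp
  | succ N ih =>
    rw [sum_range_succ, ih]
    ring

/-- The factor `m = 0` of the second product, present once `i ≥ 3`, is zero at `k = n - 1`. -/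
theorem ratCoeff_pred_eq_zero {n i : ℕ} (hn : 1 ≤ n) (hi : 3 ≤ i) : ratCoeff n i (n - 1) = 0 := by
  unfold ratCoeff
  refine mul_eq_zero_of_right _ (prod_eq_zero (i := 0) (by simp; omega) ?_)
  rw [Nat.cast_sub hn]
  simp

theorem momentTerm_eq_zero {n i j x : ℕ} (hx : j < x) (hxn : x ≤ n) : momentTerm n i j x = 0 := by
  rw [momentTerm, moment_eq_zero (by omega), mul_zero]

theorem sum_momentTerm_recurrence (n i j : ℕ) (hi : Odd i) (hji : j + 3 ≤ i + 2)
    (hin : i + 4 ≤ n) :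
    ∑ x ∈ range (j + 1), momentTerm n i j x +
        ratOne n (i + 2 : ℕ) j * ∑ x ∈ range (j + 1), momentTerm n (i + 2) j x +
        ratTwo n (i + 2 : ℕ) j * ∑ x ∈ range (j + 1), momentTerm n (i + 4) j x = 0 := by
  rw [mul_sum, mul_sum, ← sum_add_distrib, ← sum_add_distrib]
  rw [sum_congr rfl fun x hx => momentTerm_recurrence n i j x hi hji hin
    (Nat.lt_succ_iff.mp (mem_range.mp hx)), ← mul_sum,
    sum_range_add_two_sub
      (fun x : ℕ => (x : ℝ) * (2 * n - x + 3) * momentTerm n (i + 2) j x)]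
  -- Of the four boundary values, the one at `0` dies by its factor `x`, the one at `1` here, and
  -- those at `j + 1`, `j + 2` by orthogonality.
  have h1 : momentTerm n (i + 2) j 1 = 0 := by
    obtain ⟨q, rfl⟩ := hi
    rw [momentTerm, ratCoeff_pred_eq_zero (by omega) (by omega), zero_mul]
  simp only [h1, momentTerm_eq_zero (n := n) (i := i + 2) (j := j) (x := j + 1) (by omega) (by omega),
    momentTerm_eq_zero (n := n) (i := i + 2) (j := j) (x := j + 1 + 1) (by omega) (by omega)]
  simp

end AlpertWavelet

theorem theorem6 (n i j : ℕ) (hi : Odd i) (hji : j + 2 < i) (hin : i + 2 ≤ n) :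
    AlpertWavelet.matD n ⟨n - i + 2, by omega⟩ ⟨n - j, by omega⟩
      + AlpertWavelet.kOne n i j * AlpertWavelet.matD n ⟨n - i, by omega⟩ ⟨n - j, by omega⟩
      + AlpertWavelet.kTwo n i j * AlpertWavelet.matD n ⟨n - i - 2, by omega⟩ ⟨n - j, by omega⟩
      = 0 := by
  -- The three rows carry the wavelet indices `p`, `p + 2`, `p + 4`.
  obtain ⟨p, rfl⟩ : ∃ p, i = p + 2 := ⟨i - 2, by omega⟩
  have hp : Odd p := by
    obtain ⟨q, hq⟩ := hi
    exact ⟨q - 1, by omega⟩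
  have hn : (p : ℝ) + 4 ≤ n := by exact_mod_cast hin
  rw [AlpertWavelet.matD_apply_of_odd (i := p) _ _ (by omega) hp,
    AlpertWavelet.matD_apply_of_odd (i := p + 2) _ _ (by omega) hi,
    AlpertWavelet.matD_apply_of_odd (i := p + 4) _ _ (by omega) (hi.add_even even_two),
    AlpertWavelet.sum_ratCoeff_mul_moment n _ j (by omega),
    AlpertWavelet.sum_ratCoeff_mul_moment n _ j (by omega),
    AlpertWavelet.sum_ratCoeff_mul_moment n _ j (by omega),
    AlpertWavelet.kOne_eq, AlpertWavelet.kTwo_eq]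
  have key := AlpertWavelet.sum_momentTerm_recurrence n p j hp (by omega) (by omega)
  have e1 : 2 * (n : ℝ) - 2 * p + 1 = 2 * (n - (p + 2 : ℕ)) + 5 := by push_cast; ring
  have e2 : 2 * (n : ℝ) - 2 * (p + 2 : ℕ) + 1 = 2 * (n - (p + 2 : ℕ)) + 1 := by ring
  have e3 : 2 * (n : ℝ) - 2 * (p + 4 : ℕ) + 1 = 2 * (n - (p + 2 : ℕ)) - 3 := by push_cast; ring
  rw [e1, e2, e3]
  have s2 : Real.sqrt (2 * ((n : ℝ) - (p + 2 : ℕ)) + 1) ≠ 0 :=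
    Real.sqrt_ne_zero'.mpr (by push_cast; linarith)
  have s3 : Real.sqrt (2 * ((n : ℝ) - (p + 2 : ℕ)) - 3) ≠ 0 :=
    Real.sqrt_ne_zero'.mpr (by push_cast; linarith)
  generalize Real.sqrt (2 * ((n : ℝ) - (p + 2 : ℕ)) + 1) = σ₂ at *
  generalize Real.sqrt (2 * ((n : ℝ) - (p + 2 : ℕ)) - 3) = σ₃ at *
  generalize Real.sqrt (2 * ((n : ℝ) - (p + 2 : ℕ)) + 5) = σ₁
  -- The Legendre normalisation depends only on the column, so it is common to all three entries.
  generalize 2 * (Real.sqrt (2 * ((n - j : ℕ) : ℝ) + 1) / Real.sqrt 2 * (-1) ^ (n - j)) = K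
  have c2 : σ₁ / σ₂ * σ₂ = σ₁ := div_mul_cancel₀ _ s2
  have c3 : σ₁ / σ₃ * σ₃ = σ₁ := div_mul_cancel₀ _ s3
  generalize AlpertWavelet.ratOne n (p + 2 : ℕ) j = r₁ at *
  generalize AlpertWavelet.ratTwo n (p + 2 : ℕ) j = r₂ at *
  generalize ∑ x ∈ Finset.range (j + 1), AlpertWavelet.momentTerm n p j x = S₁ at *
  generalize ∑ x ∈ Finset.range (j + 1), AlpertWavelet.momentTerm n (p + 2) j x = S₂ at *
  generalize ∑ x ∈ Finset.range (j + 1), AlpertWavelet.momentTerm n (p + 4) j x = S₃ at *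
  linear_combination K * σ₁ * key + K * r₁ * S₂ * c2 + K * r₂ * S₃ * c3
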